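/- Let $n\ge 2$, let $a=\exp(2\pi i/n)$, and let $$D=\mathrm{diag}(1,a,a^2,\ldots,a^{n-1}),\qquad S=\sum_{j=1}^{n-1}E_{j,j+1}+E_{n,1}$$ be Sylvester's generators (the clock and shift matrices) in $\mathrm{Mat}_n(\mathbb C)$, where $E_{i,j}$ are the matrix units. Let $\mathfrak F$ be the free complex Lie algebra on two letters $x_D,x_S$ and let $\pi_n:\mathfrak F\to\mathrm{Mat}_n(\mathbb C)$ be the homomorphism of Lie algebras (with the commutator bracket on matrices) such that $\pi_n(x_D)=D$ and $\pi_n(x_S)=S$. A set $\mathcal R\subset\mathfrak F$ is called a set of defining relations of $\mathfrak{sl}(n)=\mathfrak{sl}(n,\mathbb C)$ for the generators $D,S$ if $\pi_n(\mathfrak F)=\mathfrak{sl}(n)$ and the ideal of $\mathfrak F$ generated by $\mathcal R$ is $\ker\pi_n$; it is called independent if no $r\in\mathcal R$ lies in the ideal generated by $\mathcal R\setminus\{r\}$. Let $R(n)$ be the least number of elements of an independent set of defining relations of $\mathfrak{sl}(n)$ for the generators $D,S$ ($R(n)=\infty$ if there is no finite such set). **Theorem.** $$R(n)\le\begin{cases}2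 & \text{for } n=2,\\ n^2-3 & \text{for } n\ge 3.\end{cases}$$ -/

import Mathlib

noncomputable section

namespace Sylvester

attribute [local instance 100] LieRing.ofAssociativeRing

/-- The primitive `n`-th root of unity `a = exp (2πi/n)`. -/
def rootA (n : ℕ) : ℂ := Complex.exp (2 * Real.pi * Complex.I / n)

/-- The clock matrix `D = diag (1, a, a², …, aⁿ⁻¹)`. -/
def clock (n : ℕ) : Matrix (Fin n) (Fin n) ℂ :=
  Matrix.diagonal fun i => rootA n ^ (i : ℕ)

/-- The shift matrix `S`: ones just above the diagonal and in the lower left corner. -/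
def shift (n : ℕ) : Matrix (Fin n) (Fin n) ℂ :=
  Matrix.of fun i j => if (j : ℕ) = ((i : ℕ) + 1) % n then 1 else 0

/-- Names of the two abstract generators. -/
inductive Gen : Type
  | D
  | S

/-- The value of an abstract generator in the `n × n` matrices. -/
def genMatrix (n : ℕ) : Gen → Matrix (Fin n) (Fin n) ℂ
  | Gen.D => clock n
  | Gen.S => shift n

/-- The free complex Lie algebra on the two letters `D` and `S`. -/
abbrev FreeLie : Type := FreeLieAlgebra ℂ Gen

/-- The evaluation of Lie polynomials in the letters `D`, `S` at Sylvester's matrices.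
A relation between Sylvester's generators is an element of its kernel
(an equation `u = v` is the element `u - v`). -/
def evalHom (n : ℕ) : FreeLie →ₗ⁅ℂ⁆ Matrix (Fin n) (Fin n) ℂ :=
  FreeLieAlgebra.lift ℂ (genMatrix n)

/-- `R` is a set of defining relations of `sl(n)` for Sylvester's generators: the matrices `D`, `S`
generate exactly `sl(n)`, and the ideal of all relations between them is the Lie ideal
generated by `R`. In other words, evaluation induces an isomorphism from the free Lie algebra
modulo the ideal generated by `R` onto `sl(n)`. -/
def IsDefining (n : ℕ) (R : Set FreeLie) : Prop :=
  (evalHom n).range = LieAlgebra.SpecialLinear.sl (Fin n) ℂ ∧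
    LieSubmodule.lieSpan ℂ FreeLie R = (evalHom n).ker

/-- No relation in `R` is a consequence of the remaining ones. -/
def IsIndependent (R : Set FreeLie) : Prop :=
  ∀ r ∈ R, r ∉ LieSubmodule.lieSpan ℂ FreeLie (R \ {r})

/-- The number `R(n)` of independent defining relations between Sylvester's generators of `sl(n)`:
the least cardinality of an independent set of defining relations (`⊤` if there is no finite
one). -/
def relationNumber (n : ℕ) : ℕ∞ :=
  sInf {c : ℕ∞ | ∃ R : Set FreeLie, IsDefining n R ∧ IsIndependent R ∧ R.encard = c}

end Sylvester

end

namespace Sylvester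

attribute [local instance 100] LieRing.ofAssociativeRing

/-! ### The clock and shift matrices -/

/-! Write `n = m + 2`. Since `S D = a D S`, bracketing `D ^ i * S ^ j` with `D` or `S` raises one
exponent and multiplies by `1 - a ^ j` or `a ^ i - 1`. So all monomials `D ^ i * S ^ j` except the
identity, a basis of `sl(n)`, are reached from `D` and `S` up to nonzero factors. Lift each to a Lie
monomial and let `V` be the span of the lifts, a complement of the kernel. If, for each generator
`g` and lift `v`, `⁅g, v⁆` is congruent to an element of `V` modulo an ideal inside the kernel, that
ideal is the kernel (`lieSpan_eq_ker`).

This needs at most one relation for each of the `2(n² - 1)` brackets. None is needed for the `n² -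
3` brackets that define lifts, nor for `⁅D, D⁆`, `⁅S, S⁆`, `⁅S, D⁆`; `n² - 2` remain. For `n ≥ 3`
the Jacobi identity `⁅D, ⁅S, ⁅D, S⁆⁆⁆ = ⁅S, ⁅D, ⁅D, S⁆⁆⁆` saves one more. -/

theorem isPrimitiveRoot_rootA (m : ℕ) : IsPrimitiveRoot (rootA (m + 2)) (m + 2) :=
  Complex.isPrimitiveRoot_exp (m + 2) (by omega)

theorem shift_apply (m : ℕ) (r s : Fin (m + 2)) :
    shift (m + 2) r s = if s = r + 1 then 1 else 0 := by
  simp [shift, Fin.ext_iff, Fin.val_add]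

theorem clock_pow (m i : ℕ) :
    clock (m + 2) ^ i = Matrix.diagonal fun r : Fin (m + 2) => rootA (m + 2) ^ ((r : ℕ) * i) := by
  rw [clock, Matrix.diagonal_pow]
  congr 1
  ext r
  simp [pow_mul]

theorem ofNat_add_one (m k : ℕ) : Fin.ofNat (m + 2) (k + 1) = Fin.ofNat (m + 2) k + 1 := by
  ext
  simp [Fin.val_add]

theorem shift_pow_apply (m k : ℕ) (r s : Fin (m + 2)) :
    (shift (m + 2) ^ k) r s = if s = r + Fin.ofNat (m + 2) k then 1 else 0 := by
  induction k generalizing s with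
  | zero => simp [Matrix.one_apply, eq_comm]
  | succ k ih =>
    rw [pow_succ, Matrix.mul_apply]
    simp only [ih, shift_apply, ofNat_add_one]
    rw [Finset.sum_eq_single (r + Fin.ofNat (m + 2) k)]
    · simp [add_assoc, -Fin.ofNat_eq_cast]
    · intro x _ hx
      rw [if_neg hx, zero_mul]
    · simp

theorem clock_pow_self (m : ℕ) : clock (m + 2) ^ (m + 2) = 1 := by
  rw [clock_pow, ← Matrix.diagonal_one]
  congr 1
  ext r
  rw [mul_comm, pow_mul, (isPrimitiveRoot_rootA m).pow_eq_one, one_pow]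

theorem shift_pow_self (m : ℕ) : shift (m + 2) ^ (m + 2) = 1 := by
  ext r s
  have h : Fin.ofNat (m + 2) (m + 2) = 0 := by ext; simp
  rw [shift_pow_apply, h, add_zero, Matrix.one_apply]
  simp [eq_comm]

theorem rootA_pow_val_add_one (m : ℕ) (r : Fin (m + 2)) :
    rootA (m + 2) ^ ((r + 1 : Fin (m + 2)) : ℕ) = rootA (m + 2) ^ ((r : ℕ) + 1) := by
  rw [Fin.val_add, ← pow_mod_orderOf _ ((r : ℕ) + 1), ← (isPrimitiveRoot_rootA m).eq_orderOf]
  simp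

theorem shift_mul_clock (m : ℕ) :
    shift (m + 2) * clock (m + 2) = rootA (m + 2) • (clock (m + 2) * shift (m + 2)) := by
  ext r s
  rw [clock, Matrix.mul_diagonal, Matrix.smul_apply, Matrix.diagonal_mul, shift_apply]
  split_ifs with h
  · rw [h, rootA_pow_val_add_one, pow_succ]
    simp [mul_comm]
  · simp

theorem shift_mul_clock_pow (m i : ℕ) :
    shift (m + 2) * clock (m + 2) ^ i
      = rootA (m + 2) ^ i • (clock (m + 2) ^ i * shift (m + 2)) := by
  induction i with
  | zero => simp
  | succ i ih =>
    rw [pow_succ, ← mul_assoc, ih, smul_mul_assoc, mul_assoc, shift_mul_clock, mul_smul_comm,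
      smul_smul, pow_succ, mul_assoc]

theorem shift_pow_mul_clock (m j : ℕ) :
    shift (m + 2) ^ j * clock (m + 2)
      = rootA (m + 2) ^ j • (clock (m + 2) * shift (m + 2) ^ j) := by
  induction j with
  | zero => simp
  | succ j ih =>
    rw [pow_succ, mul_assoc, shift_mul_clock, mul_smul_comm, ← mul_assoc, ih, smul_mul_assoc,
      smul_smul, pow_succ, mul_comm (rootA _), mul_assoc]

theorem clock_lie (m i j : ℕ) :
    ⁅clock (m + 2), clock (m + 2) ^ i * shift (m + 2) ^ j⁆
      = (1 - rootA (m + 2) ^ j) • (clock (m + 2) ^ (i + 1) * shift (m + 2) ^ j) := by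
  rw [Ring.lie_def, mul_assoc _ (shift _ ^ j), shift_pow_mul_clock, mul_smul_comm, ← mul_assoc,
    ← mul_assoc, ← pow_succ, ← pow_succ', sub_smul, one_smul]

theorem shift_lie (m i j : ℕ) :
    ⁅shift (m + 2), clock (m + 2) ^ i * shift (m + 2) ^ j⁆
      = (rootA (m + 2) ^ i - 1) • (clock (m + 2) ^ i * shift (m + 2) ^ (j + 1)) := by
  rw [Ring.lie_def, ← mul_assoc, shift_mul_clock_pow, smul_mul_assoc, mul_assoc, mul_assoc,
    ← pow_succ, ← pow_succ', sub_smul, one_smul]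

theorem rootA_pow_sub_one_ne_zero {m i : ℕ} (h0 : i ≠ 0) (h : i < m + 2) :
    rootA (m + 2) ^ i - 1 ≠ 0 :=
  sub_ne_zero.2 ((isPrimitiveRoot_rootA m).pow_ne_one_of_pos_of_lt h0 h)

theorem clock_pow_mul_shift_pow_apply (m i j : ℕ) (r s : Fin (m + 2)) :
    (clock (m + 2) ^ i * shift (m + 2) ^ j) r s
      = if s = r + Fin.ofNat (m + 2) j then rootA (m + 2) ^ ((r : ℕ) * i) else 0 := by
  rw [clock_pow, Matrix.diagonal_mul, shift_pow_apply]
  simp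

/-- The entries at `(r, r + j + 1)` see only the monomials with `S`-exponent `j + 1`. For fixed `j`
they form a Vandermonde system with distinct nodes `a ^ r`, after cancelling one factor `a ^ r`. -/
theorem linearIndependent_clock_pow_mul_shift_pow (m : ℕ) :
    LinearIndependent ℂ fun p : Fin (m + 2) × Fin (m + 2) =>
      clock (m + 2) ^ ((p.1 : ℕ) + 1) * shift (m + 2) ^ ((p.2 : ℕ) + 1) := by
  rw [Fintype.linearIndependent_iff]
  intro g hg
  suffices ∀ j, (fun i => g (i, j)) = 0 from fun p => congr_fun (this p.2) p.1
  intro j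
  refine Matrix.eq_zero_of_forall_index_sum_mul_pow_eq_zero
    (f := fun r : Fin (m + 2) => rootA (m + 2) ^ (r : ℕ)) ?_ ?_
  · intro r s h
    exact Fin.ext ((isPrimitiveRoot_rootA m).pow_inj r.2 s.2 h)
  · intro r
    have h := congr_fun (congr_fun hg r) (r + j + 1)
    rw [Matrix.sum_apply, Fintype.sum_prod_type] at h
    have hne : rootA (m + 2) ^ (r : ℕ) ≠ 0 :=
      pow_ne_zero _ ((isPrimitiveRoot_rootA m).ne_zero (by omega))
    apply mul_left_cancel₀ hne
    rw [mul_zero, Finset.mul_sum]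
    refine Eq.trans (Finset.sum_congr rfl fun i _ => ?_) h
    rw [Finset.sum_eq_single j]
    · simp only [Matrix.smul_apply, clock_pow_mul_shift_pow_apply]
      simp [add_assoc, ofNat_add_one, -Fin.ofNat_eq_cast]
      ring
    · intro k _ hk
      simp only [Matrix.smul_apply, clock_pow_mul_shift_pow_apply]
      simp [add_assoc, ofNat_add_one, -Fin.ofNat_eq_cast, hk.symm]
    · simp

theorem trace_clock (m : ℕ) : (clock (m + 2)).trace = 0 := by
  rw [clock, Matrix.trace_diagonal, Fin.sum_univ_eq_sum_range fun i => rootA (m + 2) ^ i]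
  exact (isPrimitiveRoot_rootA m).geom_sum_eq_zero (by omega)

theorem trace_shift (m : ℕ) : (shift (m + 2)).trace = 0 := by
  simp [Matrix.trace, shift_apply]

/-! ### Presentations by generators and relations -/

/-- The abstract generator named `g`. -/
noncomputable abbrev gen (g : Gen) : FreeLie := FreeLieAlgebra.of ℂ g

/-- The universal property gives a map to `K` which, followed by the inclusion, fixes the generators
and hence is the identity. -/
theorem lieSubalgebra_eq_top {K : LieSubalgebra ℂ FreeLie} (h : ∀ g, gen g ∈ K) : K = ⊤ := by
  let φ : FreeLie →ₗ⁅ℂ⁆ K := FreeLieAlgebra.lift ℂ fun g => ⟨gen g, h g⟩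
  have hφ : K.incl.comp φ = LieHom.id := by
    apply FreeLieAlgebra.hom_ext
    intro g
    simp [φ]
  refine eq_top_iff.2 fun x _ => ?_
  have hx : (φ x : FreeLie) = x := LieHom.congr_fun hφ x
  exact hx ▸ (φ x).2

/-- The elements whose adjoint action preserves `U` form a subalgebra containing the generators, so
all of them do. Hence `U` is itself a subalgebra. -/
theorem submodule_eq_top {U : Submodule ℂ FreeLie} (hgen : ∀ g, gen g ∈ U)
    (hlie : ∀ g, ∀ u ∈ U, ⁅gen g, u⁆ ∈ U) : U = ⊤ := by
  let K : LieSubalgebra ℂ FreeLie :=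
    { carrier := {x | ∀ u ∈ U, ⁅x, u⁆ ∈ U}
      add_mem' := fun hx hy u hu => by
        rw [add_lie]
        exact U.add_mem (hx u hu) (hy u hu)
      zero_mem' := fun u _ => by simp
      smul_mem' := fun c x hx u hu => by
        rw [smul_lie]
        exact U.smul_mem c (hx u hu)
      lie_mem' := fun {x y} hx hy u hu => by
        rw [lie_lie]
        exact U.sub_mem (hx _ (hy u hu)) (hy _ (hx u hu)) }
  have hK : K = ⊤ := lieSubalgebra_eq_top hlie
  let A : LieSubalgebra ℂ FreeLie :=
    { U with
      lie_mem' := fun {x y} _ hy => (hK ▸ LieSubalgebra.mem_top x : x ∈ K) y hy }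
  have hA : A = ⊤ := lieSubalgebra_eq_top hgen
  exact eq_top_iff.2 fun x _ => (hA ▸ LieSubalgebra.mem_top x : x ∈ A)

/-- By the stability hypothesis `V` plus the ideal is everything. The `V`-component of a kernel
element then lies in the kernel, so it vanishes by disjointness. -/
theorem lieSpan_eq_ker {n : ℕ} {R : Set FreeLie} {V : Submodule ℂ FreeLie}
    (hR : ∀ r ∈ R, evalHom n r = 0) (hV : Disjoint V (evalHom n : FreeLie →ₗ[ℂ] Matrix (Fin n) (Fin n) ℂ).ker)
    (hgen : ∀ g, gen g ∈ V)
    (hlie : ∀ g, ∀ v ∈ V, ⁅gen g, v⁆ ∈ V ⊔ (LieSubmodule.lieSpan ℂ FreeLie R).toSubmodule) :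
    LieSubmodule.lieSpan ℂ FreeLie R = (evalHom n).ker := by
  have hle : LieSubmodule.lieSpan ℂ FreeLie R ≤ (evalHom n).ker :=
    LieSubmodule.lieSpan_le.2 fun r hr => LieHom.mem_ker.2 (hR r hr)
  refine le_antisymm hle fun x hx => ?_
  have htop : V ⊔ (LieSubmodule.lieSpan ℂ FreeLie R).toSubmodule = ⊤ := by
    refine submodule_eq_top (fun g => Submodule.mem_sup_left (hgen g)) fun g u hu => ?_
    obtain ⟨v, hv, w, hw, rfl⟩ := Submodule.mem_sup.1 hu
    rw [lie_add]
    exact Submodule.add_mem _ (hlie g v hv)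
      (Submodule.mem_sup_right ((LieSubmodule.lieSpan ℂ FreeLie R).lie_mem hw))
  obtain ⟨v, hv, w, hw, rfl⟩ := Submodule.mem_sup.1 (htop ▸ Submodule.mem_top : x ∈ _)
  have h0 : evalHom n w = 0 := LieHom.mem_ker.1 (hle hw)
  have h1 : evalHom n (v + w) = 0 := LieHom.mem_ker.1 hx
  rw [map_add, h0, add_zero] at h1
  have : v = 0 := Submodule.disjoint_def.1 hV v hv h1
  rw [this, zero_add]
  exact hw

/-- A finite set of relations contains an independent one which spans the same ideal. -/
theorem exists_isIndependent_subset (R : Finset FreeLie) :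
    ∃ T ⊆ R, IsIndependent (T : Set FreeLie) ∧
      LieSubmodule.lieSpan ℂ FreeLie (T : Set FreeLie)
        = LieSubmodule.lieSpan ℂ FreeLie (R : Set FreeLie) := by
  classical
  induction R using Finset.strongInduction with
  | H R ih =>
    by_cases hR : IsIndependent (R : Set FreeLie)
    · exact ⟨R, subset_rfl, hR, rfl⟩
    · simp only [IsIndependent, not_forall, not_not] at hR
      obtain ⟨r, hr, hmem⟩ := hR
      obtain ⟨T, hT, hind, hspan⟩ := ih (R.erase r) (Finset.erase_ssubset hr)
      refine ⟨T, hT.trans (Finset.erase_subset _ _), hind, hspan.trans ?_⟩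
      rw [Finset.coe_erase]
      refine le_antisymm (LieSubmodule.lieSpan_mono Set.sdiff_subset) ?_
      refine LieSubmodule.lieSpan_le.2 fun x hx => ?_
      by_cases hxr : x = r
      · exact hxr ▸ hmem
      · exact LieSubmodule.subset_lieSpan ⟨hx, hxr⟩

theorem relationNumber_le {n : ℕ} {R : Finset FreeLie} (h : IsDefining n (R : Set FreeLie)) :
    relationNumber n ≤ R.card := by
  obtain ⟨T, hTR, hT, hspan⟩ := exists_isIndependent_subset R
  calc relationNumber n ≤ (T : Set FreeLie).encard := sInf_le ⟨T, ⟨h.1, hspan.trans h.2⟩, hT, rfl⟩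
    _ ≤ (R : Set FreeLie).encard := Set.encard_le_encard (Finset.coe_subset.2 hTR)
    _ = R.card := Set.encard_coe_eq_coe_finsetCard R

/-! ### Lifts of the monomials in the clock and shift matrices -/

@[simp]
theorem evalHom_gen (n : ℕ) (g : Gen) : evalHom n (gen g) = genMatrix n g :=
  FreeLieAlgebra.lift_of_apply _ _

theorem evalHom_range_le (m : ℕ) :
    (evalHom (m + 2)).range ≤ LieAlgebra.SpecialLinear.sl (Fin (m + 2)) ℂ := by
  rw [LieHom.range_eq_map, LieSubalgebra.map_le_iff_le_comap, top_le_iff]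
  apply lieSubalgebra_eq_top
  intro g
  change (evalHom (m + 2) (gen g)).trace = 0
  rw [evalHom_gen]
  cases g
  · exact trace_clock m
  · exact trace_shift m

/-- The Lie monomial `(ad x_S) ^ j (ad x_D) ^ (i + 1) x_S`. -/
noncomputable def word (i j : ℕ) : FreeLie :=
  (fun z => ⁅gen Gen.S, z⁆)^[j] ((fun z => ⁅gen Gen.D, z⁆)^[i + 1] (gen Gen.S))

theorem lie_S_word (i j : ℕ) : ⁅gen Gen.S, word i j⁆ = word i (j + 1) := by
  simp only [word, Function.iterate_succ_apply' _ j]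

theorem lie_D_word_zero (i : ℕ) : ⁅gen Gen.D, word i 0⁆ = word (i + 1) 0 := by
  simp only [word, Function.iterate_succ_apply' _ (i + 1), Function.iterate_zero, id]

theorem word_zero_zero : word 0 0 = ⁅gen Gen.D, gen Gen.S⁆ := rfl

/-- The redundant relation: `[D, [S, [D, S]]] = [S, [D, [D, S]]]`. -/
theorem lie_D_word_zero_one : ⁅gen Gen.D, word 0 1⁆ = word 1 1 := by
  rw [← lie_S_word 1 0, ← lie_D_word_zero, ← lie_S_word 0 0, word_zero_zero,
    leibniz_lie (gen Gen.D) (gen Gen.S), lie_self, zero_add]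

theorem evalHom_word {m i : ℕ} (hi : i ≤ m) (j : ℕ) :
    ∃ c : ℂ, c ≠ 0 ∧ evalHom (m + 2) (word i j)
      = c • (clock (m + 2) ^ (i + 1) * shift (m + 2) ^ (j + 1)) := by
  induction j with
  | zero =>
    -- Bracketing with `D` at `S`-exponent `1` always gives the factor `1 - a`, so the bound on `i`
    -- matters only for brackets with `S`.
    clear hi
    induction i with
    | zero =>
      refine ⟨_, neg_ne_zero.2
        (rootA_pow_sub_one_ne_zero (m := m) one_ne_zero (by omega)), ?_⟩
      rw [word_zero_zero, LieHom.map_lie, evalHom_gen, evalHom_gen, neg_sub]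
      simpa [genMatrix] using clock_lie m 0 1
    | succ i ih =>
      obtain ⟨c, hc, h⟩ := ih
      refine ⟨_, mul_ne_zero hc (neg_ne_zero.2
        (rootA_pow_sub_one_ne_zero (m := m) one_ne_zero (by omega))), ?_⟩
      rw [← lie_D_word_zero, LieHom.map_lie, h, evalHom_gen, lie_smul]
      simp only [genMatrix]
      rw [clock_lie, smul_smul, neg_sub, zero_add]
  | succ j ih =>
    obtain ⟨c, hc, h⟩ := ih
    refine ⟨_, mul_ne_zero hc
      (rootA_pow_sub_one_ne_zero (m := m) (i := i + 1) (by omega) (by omega)), ?_⟩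
    rw [← lie_S_word, LieHom.map_lie, h, evalHom_gen, lie_smul]
    simp only [genMatrix]
    rw [shift_lie, smul_smul]

/-- A lift to the free Lie algebra of a nonzero multiple of `D ^ (i + 1) * S ^ (j + 1)` for
`n = m + 2` and `i, j < n` not both equal to `n - 1`. -/
noncomputable def monomialLift (m i j : ℕ) : FreeLie :=
  if i = m + 1 then (if j = 0 then gen Gen.S else ⁅gen Gen.D, word m j⁆)
  else if i = 0 ∧ j = m + 1 then gen Gen.D else word i j

theorem monomialLift_eq_word {m i j : ℕ} (hi : i ≤ m) (hj : j ≤ m) :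
    monomialLift m i j = word i j := by
  rw [monomialLift, if_neg (by omega), if_neg (by omega)]

theorem monomialLift_eq_word' {m i : ℕ} (h0 : i ≠ 0) (hi : i ≤ m) (j : ℕ) :
    monomialLift m i j = word i j := by
  rw [monomialLift, if_neg (by omega), if_neg (by omega)]

theorem monomialLift_S (m : ℕ) : monomialLift m (m + 1) 0 = gen Gen.S := by
  rw [monomialLift, if_pos rfl, if_pos rfl]

theorem monomialLift_D (m : ℕ) : monomialLift m 0 (m + 1) = gen Gen.D := by
  rw [monomialLift, if_neg (by omega), if_pos ⟨rfl, rfl⟩]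

theorem monomialLift_last (m : ℕ) {j : ℕ} (hj : j ≠ 0) :
    monomialLift m (m + 1) j = ⁅gen Gen.D, word m j⁆ := by
  rw [monomialLift, if_pos rfl, if_neg hj]

theorem evalHom_monomialLift {m i j : ℕ} (hi : i ≤ m + 1) (hj : j ≤ m + 1)
    (h : ¬(i = m + 1 ∧ j = m + 1)) :
    ∃ c : ℂ, c ≠ 0 ∧ evalHom (m + 2) (monomialLift m i j)
      = c • (clock (m + 2) ^ (i + 1) * shift (m + 2) ^ (j + 1)) := by
  rw [monomialLift]
  split_ifs with h1 h2 h3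
  · refine ⟨1, one_ne_zero, ?_⟩
    simp [h1, h2, clock_pow_self, genMatrix]
  · obtain ⟨c, hc, hw⟩ := evalHom_word (le_refl m) j
    refine ⟨_, mul_ne_zero hc (neg_ne_zero.2
      (rootA_pow_sub_one_ne_zero (m := m) (i := j + 1) (by omega) (by omega))), ?_⟩
    rw [LieHom.map_lie, hw, evalHom_gen, lie_smul]
    simp only [genMatrix]
    rw [clock_lie, smul_smul, neg_sub, h1]
  · refine ⟨1, one_ne_zero, ?_⟩
    simp [h3, shift_pow_self, genMatrix]
  · exact evalHom_word (by omega) j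

/-- The index set of the nontrivial monomials. -/
abbrev Index (m : ℕ) : Type :=
  {p : Fin (m + 2) × Fin (m + 2) // p ≠ (Fin.last (m + 1), Fin.last (m + 1))}

theorem linearIndependent_evalHom_monomialLift (m : ℕ) :
    LinearIndependent ℂ ((evalHom (m + 2) : FreeLie →ₗ[ℂ] Matrix (Fin (m + 2)) (Fin (m + 2)) ℂ) ∘
      fun p : Index m => monomialLift m p.1.1 p.1.2) := by
  have h : ∀ p : Index m, ∃ c : ℂ, c ≠ 0 ∧ evalHom (m + 2) (monomialLift m p.1.1 p.1.2)
      = c • (clock (m + 2) ^ ((p.1.1 : ℕ) + 1) * shift (m + 2) ^ ((p.1.2 : ℕ) + 1)) := by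
    rintro ⟨⟨i, j⟩, hp⟩
    refine evalHom_monomialLift (by omega) (by omega) fun h => hp ?_
    exact Prod.ext (Fin.ext h.1) (Fin.ext h.2)
  choose c hc h using h
  have hli := ((linearIndependent_clock_pow_mul_shift_pow m).comp
    (Subtype.val : Index m → _) Subtype.val_injective).units_smul fun p => Units.mk0 (c p) (hc p)
  convert hli using 1
  ext1 p
  exact h p

/-- The span of the lifted monomials. -/
noncomputable def liftSpan (m : ℕ) : Submodule ℂ FreeLie :=
  Submodule.span ℂ (Set.range fun p : Index m => monomialLift m p.1.1 p.1.2)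

theorem monomialLift_mem_liftSpan {m i j : ℕ} (hi : i ≤ m + 1) (hj : j ≤ m + 1)
    (h : ¬(i = m + 1 ∧ j = m + 1)) : monomialLift m i j ∈ liftSpan m :=
  Submodule.subset_span ⟨⟨(⟨i, by omega⟩, ⟨j, by omega⟩), by
    simpa [Prod.ext_iff, Fin.ext_iff] using h⟩, rfl⟩

theorem disjoint_liftSpan_ker (m : ℕ) : Disjoint (liftSpan m)
    (evalHom (m + 2) : FreeLie →ₗ[ℂ] Matrix (Fin (m + 2)) (Fin (m + 2)) ℂ).ker :=
  Submodule.range_ker_disjoint (linearIndependent_evalHom_monomialLift m)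

/-- Dimension count: there are `n ^ 2 - 1` independent images, and `sl(n)` is a proper subspace
because the identity has nonzero trace. -/
theorem map_liftSpan (m : ℕ) :
    (liftSpan m).map (evalHom (m + 2) : FreeLie →ₗ[ℂ] Matrix (Fin (m + 2)) (Fin (m + 2)) ℂ)
      = (LieAlgebra.SpecialLinear.sl (Fin (m + 2)) ℂ).toSubmodule := by
  apply Submodule.eq_of_le_of_finrank_le
  · rintro _ ⟨x, _, rfl⟩
    exact evalHom_range_le m ⟨x, rfl⟩
  · rw [liftSpan, Submodule.map_span, ← Set.range_comp,
      finrank_span_eq_card (linearIndependent_evalHom_monomialLift m)]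
    have hlt : (LieAlgebra.SpecialLinear.sl (Fin (m + 2)) ℂ).toSubmodule < ⊤ := by
      refine lt_top_iff_ne_top.2 fun htop => ?_
      have h1 : (1 : Matrix (Fin (m + 2)) (Fin (m + 2)) ℂ)
          ∈ (LieAlgebra.SpecialLinear.sl (Fin (m + 2)) ℂ).toSubmodule := htop ▸ Submodule.mem_top
      change (1 : Matrix (Fin (m + 2)) (Fin (m + 2)) ℂ).trace = 0 at h1
      rw [Matrix.trace_one, Fintype.card_fin] at h1
      exact absurd h1 (Nat.cast_ne_zero.2 (by omega))
    have := Submodule.finrank_lt_finrank_of_lt hlt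
    rw [finrank_top, Module.finrank_matrix] at this
    simp [Fintype.card_subtype_compl] at this ⊢
    omega

theorem evalHom_range (m : ℕ) :
    (evalHom (m + 2)).range = LieAlgebra.SpecialLinear.sl (Fin (m + 2)) ℂ := by
  refine le_antisymm (evalHom_range_le m) fun A hA => ?_
  obtain ⟨x, _, rfl⟩ : A ∈ (liftSpan m).map
      (evalHom (m + 2) : FreeLie →ₗ[ℂ] Matrix (Fin (m + 2)) (Fin (m + 2)) ℂ) :=
    (map_liftSpan m).symm ▸ hA
  exact ⟨x, rfl⟩

theorem exists_mem_liftSpan_evalHom_eq (m : ℕ) (z : FreeLie) :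
    ∃ v ∈ liftSpan m, evalHom (m + 2) v = evalHom (m + 2) z := by
  have h : evalHom (m + 2) z ∈ (liftSpan m).map
      (evalHom (m + 2) : FreeLie →ₗ[ℂ] Matrix (Fin (m + 2)) (Fin (m + 2)) ℂ) :=
    (map_liftSpan m).symm ▸ evalHom_range_le m ⟨z, rfl⟩
  exact h

/-! ### The relations -/

open scoped Classical in
/-- The brackets of generators with lifted monomials which give rise to a relation. -/
noncomputable def brackets (m : ℕ) : Finset FreeLie :=
  {⁅gen Gen.D, word m 0⁆, ⁅gen Gen.S, word 0 m⁆}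
    ∪ ((insert (m + 1) (Finset.range m) ×ˢ Finset.Icc 1 m).erase (0, 1)).image
        (fun p => ⁅gen Gen.D, monomialLift m p.1 p.2⁆)
    ∪ (Finset.Icc 1 m).image (fun i => ⁅gen Gen.D, monomialLift m i (m + 1)⁆)
    ∪ (Finset.Icc 1 m).image (fun i => ⁅gen Gen.S, monomialLift m i (m + 1)⁆)
    ∪ (Finset.Icc 1 m).image (fun j => ⁅gen Gen.S, monomialLift m (m + 1) j⁆)

theorem card_brackets_le (m : ℕ) : (brackets m).card ≤ 2 + ((m + 1) * m - 1) + 3 * m := by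
  classical
  have h1 : ∀ f : ℕ → FreeLie, ((Finset.Icc 1 m).image f).card ≤ m := fun f =>
    Finset.card_image_le.trans (by simp)
  have h2 : ((insert (m + 1) (Finset.range m) ×ˢ Finset.Icc 1 m).erase (0, 1)).card
      ≤ (m + 1) * m - 1 := by
    -- The erased pair `(0, 1)` is present only for `m ≥ 1`; this is why `n = 2` is exceptional.
    rcases Nat.eq_zero_or_pos m with rfl | hm
    · simp
    · rw [Finset.card_erase_of_mem (by simp; omega), Finset.card_product,
        Finset.card_insert_of_notMem (by simp)]
      simp
  have h3 := (Finset.card_image_le (f := fun p : ℕ × ℕ =>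
    ⁅gen Gen.D, monomialLift m p.1 p.2⁆)).trans h2
  have h4 := Finset.card_le_two (a := ⁅gen Gen.D, word m 0⁆) (b := ⁅gen Gen.S, word 0 m⁆)
  unfold brackets
  refine (Finset.card_union_le _ _).trans (le_trans (Nat.add_le_add ((Finset.card_union_le _ _).trans
    (Nat.add_le_add ((Finset.card_union_le _ _).trans (Nat.add_le_add ((Finset.card_union_le _ _).trans
    (Nat.add_le_add h4 h3)) (h1 _))) (h1 _))) (h1 _)) ?_)
  omega

/-- The brackets landing in the span are those that build the next lift, the trivial ones among the
generators, and the one identified by Jacobi. -/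
theorem lie_monomialLift_mem (m : ℕ) (g : Gen) {i j : ℕ} (hi : i ≤ m + 1) (hj : j ≤ m + 1)
    (h : ¬(i = m + 1 ∧ j = m + 1)) :
    ⁅gen g, monomialLift m i j⁆ ∈ liftSpan m ∨ ⁅gen g, monomialLift m i j⁆ ∈ brackets m := by
  simp only [brackets, Finset.mem_union, Finset.mem_insert, Finset.mem_singleton,
    Finset.mem_image, Finset.mem_erase, Finset.mem_product, Finset.mem_Icc, Finset.mem_range]
  cases g with
  | D =>
    rcases hi.eq_or_lt with rfl | hi'
    · rcases Nat.eq_zero_or_pos j with rfl | hj0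
      · left
        rw [monomialLift_S, ← word_zero_zero, ← monomialLift_eq_word (Nat.zero_le m) (Nat.zero_le m)]
        exact monomialLift_mem_liftSpan (by omega) (by omega) (by omega)
      · exact Or.inr <| .inl <| .inl <| .inl <| .inr
          ⟨(m + 1, j), ⟨by simp, .inl rfl, by omega, by omega⟩, rfl⟩
    · rcases hj.eq_or_lt with rfl | hj'
      · rcases Nat.eq_zero_or_pos i with rfl | hi0
        · left
          rw [monomialLift_D, lie_self]
          exact zero_mem _
        · exact Or.inr <| .inl <| .inl <| .inr ⟨i, ⟨by omega, by omega⟩, rfl⟩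
      · rcases Nat.eq_zero_or_pos j with rfl | hj0
        · rw [monomialLift_eq_word (by omega) (by omega)]
          rcases (Nat.lt_succ_iff.1 hi').eq_or_lt with rfl | hlt
          · exact Or.inr <| .inl <| .inl <| .inl <| .inl <| .inl rfl
          · left
            rw [lie_D_word_zero, ← monomialLift_eq_word (m := m) (by omega) (by omega)]
            exact monomialLift_mem_liftSpan (by omega) (by omega) (by omega)
        · rcases (Nat.lt_succ_iff.1 hi').eq_or_lt with rfl | hlt
          · left
            rw [monomialLift_eq_word (by omega) (by omega), ← monomialLift_last _ (by omega)]
            exact monomialLift_mem_liftSpan (by omega) (by omega) (by omega)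
          · by_cases h01 : (i, j) = (0, 1)
            · obtain ⟨rfl, rfl⟩ := Prod.mk.inj h01
              left
              rw [monomialLift_eq_word (by omega) (by omega), lie_D_word_zero_one,
                ← monomialLift_eq_word (m := m) (by omega) (by omega)]
              exact monomialLift_mem_liftSpan (by omega) (by omega) (by omega)
            · exact Or.inr <| .inl <| .inl <| .inl <| .inr
                ⟨(i, j), ⟨h01, .inr hlt, by omega, by omega⟩, rfl⟩
  | S =>
    rcases hi.eq_or_lt with rfl | hi'
    · rcases Nat.eq_zero_or_pos j with rfl | hj0
      · left
        rw [monomialLift_S, lie_self]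
        exact zero_mem _
      · exact Or.inr <| .inr ⟨j, ⟨by omega, by omega⟩, rfl⟩
    · rcases hj.eq_or_lt with rfl | hj'
      · rcases Nat.eq_zero_or_pos i with rfl | hi0
        · left
          rw [monomialLift_D, ← lie_skew, ← word_zero_zero,
            ← monomialLift_eq_word (Nat.zero_le m) (Nat.zero_le m)]
          exact neg_mem (monomialLift_mem_liftSpan (by omega) (by omega) (by omega))
        · exact Or.inr <| .inl <| .inr ⟨i, ⟨by omega, by omega⟩, rfl⟩
      · rw [monomialLift_eq_word (by omega) (by omega)]
        rcases Nat.eq_zero_or_pos i with rfl | hi0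
        · rcases (Nat.lt_succ_iff.1 hj').eq_or_lt with rfl | hlt
          · exact Or.inr <| .inl <| .inl <| .inl <| .inl <| .inr rfl
          · left
            rw [lie_S_word, ← monomialLift_eq_word (m := m) (by omega) (by omega)]
            exact monomialLift_mem_liftSpan (by omega) (by omega) (by omega)
        · left
          rw [lie_S_word, ← monomialLift_eq_word' (m := m) (by omega) (by omega)]
          exact monomialLift_mem_liftSpan (by omega) (by omega) (by omega)

theorem exists_isDefining (m : ℕ) :
    ∃ R : Finset FreeLie, IsDefining (m + 2) (R : Set FreeLie) ∧
      R.card ≤ 2 + ((m + 1) * m - 1) + 3 * m := by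
  classical
  -- `ρ z` is the representative in `V` of the value of `z`, so `z - ρ z` is the relation rewriting
  -- `z` into `V`.
  choose ρ hρ hev using exists_mem_liftSpan_evalHom_eq m
  refine ⟨(brackets m).image fun z => z - ρ z, ⟨evalHom_range m, ?_⟩,
    Finset.card_image_le.trans (card_brackets_le m)⟩
  refine lieSpan_eq_ker (V := liftSpan m) ?_ (disjoint_liftSpan_ker m) ?_ ?_
  · intro r hr
    obtain ⟨z, _, rfl⟩ := Finset.mem_image.1 hr
    rw [map_sub, hev, sub_self]
  · rintro (_ | _)
    · rw [← monomialLift_D m]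
      exact monomialLift_mem_liftSpan (by omega) (by omega) (by omega)
    · rw [← monomialLift_S m]
      exact monomialLift_mem_liftSpan (by omega) (by omega) (by omega)
  · intro g v hv
    induction hv using Submodule.span_induction with
    | zero =>
      rw [lie_zero]
      exact zero_mem _
    | add x y _ _ hx hy =>
      rw [lie_add]
      exact add_mem hx hy
    | smul c x _ hx =>
      rw [lie_smul]
      exact Submodule.smul_mem _ c hx
    | mem x hx =>
      obtain ⟨⟨⟨i, j⟩, hp⟩, rfl⟩ := hx
      rcases lie_monomialLift_mem m g (i := i) (j := j) (by omega) (by omega)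
        (fun h => hp (Prod.ext (Fin.ext h.1) (Fin.ext h.2))) with h | h
      · exact Submodule.mem_sup_left h
      · rw [← add_sub_cancel (ρ ⁅gen g, monomialLift m i j⁆) ⁅gen g, monomialLift m i j⁆]
        exact Submodule.add_mem_sup (hρ _)
          (LieSubmodule.subset_lieSpan (Finset.mem_coe.2 (Finset.mem_image_of_mem _ h)))

end Sylvester

theorem mainTheorem3 :
    Sylvester.relationNumber 2 ≤ 2 ∧
      ∀ n : ℕ, 3 ≤ n → Sylvester.relationNumber n ≤ ((n ^ 2 - 3 : ℕ) : ℕ∞) := by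
  have key : ∀ m, Sylvester.relationNumber (m + 2)
      ≤ ((2 + ((m + 1) * m - 1) + 3 * m : ℕ) : ℕ∞) := fun m => by
    obtain ⟨R, hR, hcard⟩ := Sylvester.exists_isDefining m
    exact (Sylvester.relationNumber_le hR).trans (Nat.cast_le.2 hcard)
  -- At `m = 0` the truncated subtraction gives `0`, leaving `2`; for `m ≥ 1` the bound in `key`
  -- equals `(m + 2) ^ 2 - 3`.
  refine ⟨by simpa using key 0, fun n hn => ?_⟩
  obtain ⟨m, rfl⟩ := Nat.exists_eq_add_of_le' hn
  refine (key (m + 1)).trans (Nat.cast_le.2 ?_)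
  have h1 : (m + 1 + 1) * (m + 1) = m ^ 2 + 3 * m + 2 := by ring
  have h2 : (m + 3) ^ 2 = m ^ 2 + 6 * m + 9 := by ring
  omega
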